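/- For integers $k$ put $\frac1{k!}=0$ if $k<0$, and let $(a)_k=a(a+1)\cdots(a+k-1)$ for $k\ge 1$, $(a)_0=1$. Then for every positive integer $n$ and every nonnegative integer $m$, $$ \det_{1\le i,j\le 2n-1}\left(\frac{(2n+m-i-1)!}{(m+i-j)!\,(2n-2i+j)!}\cdot\begin{cases} n+m-\frac j2 & \text{if } i\ne n\\ j & \text{if } i=n\end{cases}\right) $$ $$ =\frac{1}{2^{3n-3}\,(n-1)!}\;\prod_{i=1}^{n}(2i-1)!^2\;\prod_{i=1}^{2n-1}\frac{(2n+m-i-1)!}{(m+i-1)!\,(4n-2i-1)!}\;\prod_{i=1}^{2n-2}(2m+i+1)_i\;\cdot\;\sum_{i=0}^{n-1}\frac{(-1)^{n-i-1}}{2n-2i-1}\,\frac{(m+n-i)_{2i}}{i!^2}. $$ -/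

import Mathlib

open scoped Nat

/-- The reciprocal factorial `1 / k!` of an integer `k`, equal to `0` for negative `k`. -/
def invFactorial (k : ℤ) : ℚ :=
  if 0 ≤ k then 1 / (k.toNat ! : ℚ) else 0

/-- The entry in row `i` and column `j`, where `1 ≤ i, j ≤ 2n - 1`. -/
def halfHexEntry (n m i j : ℕ) : ℚ :=
  ((2 * n + m - i - 1)! : ℚ)
    * invFactorial ((m : ℤ) + i - j) * invFactorial (2 * (n : ℤ) - 2 * i + j)
    * (if i = n then (j : ℚ) else (n : ℚ) + m - (j : ℚ) / 2)

/-- The matrix with rows and columns `1, …, 2n - 1`; the indices in `Fin` start at `0`. -/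
def halfHexMatrix (n m : ℕ) : Matrix (Fin (2 * n - 1)) (Fin (2 * n - 1)) ℚ :=
  Matrix.of fun a b => halfHexEntry n m ((a : ℕ) + 1) ((b : ℕ) + 1)

open Finset

/-! Put n = r + 1, reverse rows and columns, and multiply by the unipotent Pascal matrix. Write c_l
for `centralProd l`, monic of degree l in q(q+1), and q = m + k with 0 ≤ k ≤ 2r. Chu–Vandermonde
turns row l ≠ r into (2q+1) c_l(q) / (2 (2l+1)!), and row r into c_r(q) / (2r)!, without the factor
2q+1 (`halfHexMatrix_det_eq`). If row r had the regular form too, the determinant would be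
essentially a Vandermonde determinant in q(q+1) (`det_centralMatrix`). So row r is expanded in the
rows of `centralMatrix`; only the coefficient of row r survives, and it carries the sum in the
theorem.

The expansion needs a polynomial in q(q+1) that agrees with c_r(q)/(2q+1) at the 2r+1 points q = m +
κ (`exists_centralProd_combination`). For fixed κ, take the degree 2r polynomial f(s) = `fallingProd
(m+r+s) (2r-κ) * fallingProd (m+r+κ-s) κ` and interpolate it at s = 0, …, 2r. Its value at s = r +
1/2 is a multiple, independent of κ, of 1/(2q+1) (`prod_odd_eq_fallingProd`), while c_r(q) f(i) is
c_i(m+r) times a polynomial in q(q+1) (`centralQuot_mul_centralProd`). Taking the coefficient of c_r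
in these polynomials leaves only the terms i ≤ r. -/

/-! ### Central factorials. -/

/-- The falling product `a (a - 1) ⋯ (a - k + 1)`. -/
def fallingProd (a : ℚ) (k : ℕ) : ℚ := ∏ t ∈ range k, (a - t)

theorem fallingProd_add (a : ℚ) (k l : ℕ) :
    fallingProd a (k + l) = fallingProd a k * fallingProd (a - k) l := by
  unfold fallingProd
  rw [prod_range_add]
  congr 1
  refine prod_congr rfl fun t _ => ?_
  push_cast
  ring

/-- The central factorial `(x + l)(x + l - 1) ⋯ (x - l + 1)`, a monic polynomial of degree `l` in
`x (x + 1)`. -/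
def centralProd (l : ℕ) (x : ℚ) : ℚ := ∏ t ∈ range l, (x * (x + 1) - t * (t + 1))

theorem centralProd_succ (l : ℕ) (x : ℚ) :
    centralProd (l + 1) x = centralProd l x * (x * (x + 1) - l * (l + 1)) :=
  prod_range_succ _ _

theorem centralProd_eq_fallingProd (l : ℕ) (x : ℚ) :
    centralProd l x = fallingProd (x + l) (2 * l) := by
  induction l with
  | zero => simp [centralProd, fallingProd]
  | succ l ih =>
    rw [centralProd_succ, ih, show 2 * (l + 1) = 1 + (2 * l + 1) by ring, fallingProd_add,
      fallingProd_add]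
    have : x + ((l + 1 : ℕ) : ℚ) - ((1 : ℕ) : ℚ) = x + l := by push_cast; ring
    rw [this]
    simp only [fallingProd, prod_range_one]
    push_cast
    ring

theorem cast_choose_succ_mul (a b : ℕ) :
    (a.choose (b + 1) : ℚ) * (b + 1) = a.choose b * ((a : ℚ) - b) := by
  rcases le_or_gt b a with h | h
  · rw [← Nat.cast_sub h]
    exact_mod_cast Nat.choose_succ_right_eq a b
  · rw [Nat.choose_eq_zero_of_lt h, Nat.choose_eq_zero_of_lt (by omega)]
    simp

theorem centralProd_natCast (l q : ℕ) :
    centralProd l q = (2 * l)! * (q + l).choose (2 * l) := by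
  induction l with
  | zero => simp [centralProd]
  | succ l ih =>
    have h₁ := cast_choose_succ_mul (q + l) (2 * l)
    have h₂ : ((q + l + 1 : ℕ) : ℚ) * (q + l).choose (2 * l + 1)
        = (q + l + 1).choose (2 * l + 1 + 1) * ((2 * l + 1 + 1 : ℕ) : ℚ) := by
      exact_mod_cast Nat.add_one_mul_choose_eq (q + l) (2 * l + 1)
    rw [centralProd_succ, ih, show 2 * (l + 1) = 2 * l + 1 + 1 by ring,
      show q + (l + 1) = q + l + 1 by ring, Nat.factorial_succ, Nat.factorial_succ]
    push_cast at h₁ h₂ ⊢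
    linear_combination ((2 * l + 1) * (2 * l)! : ℚ) * h₂
      - ((2 * l)! * (q + l + 1) : ℚ) * h₁

theorem centralProd_self (r i : ℕ) (h : i ≤ r) :
    centralProd (r - i) r * i ! = (2 * r - i)! := by
  rw [centralProd_natCast]
  have := Nat.choose_mul_factorial_mul_factorial (show 2 * (r - i) ≤ r + (r - i) by omega)
  rw [show r + (r - i) - 2 * (r - i) = i by omega] at this
  rw [show 2 * r - i = r + (r - i) by omega, ← this]
  push_cast
  ring

/-! ### Lagrange interpolation at 0, …, N. -/

theorem prod_erase_natCast_sub (N i : ℕ) (hi : i ∈ range (N + 1)) :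
    ∏ j ∈ (range (N + 1)).erase i, ((i : ℚ) - j) = (-1) ^ (N - i) * i ! * (N - i)! := by
  have hiN : i ≤ N := by simpa [Nat.lt_succ_iff] using hi
  clear hi
  induction N, hiN using Nat.le_induction with
  | base =>
    rw [range_add_one, erase_insert (by simp), ← prod_range_reflect,
      ← prod_range_add_one_eq_factorial]
    push_cast
    simp only [Nat.sub_self, pow_zero, one_mul, Nat.factorial_zero, Nat.cast_one, mul_one]
    refine prod_congr rfl fun j hj => ?_
    have : j < i := mem_range.mp hj
    rw [Nat.sub_sub, Nat.cast_sub (by omega)]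
    push_cast
    ring
  | succ N hN ih =>
    rw [range_add_one, erase_insert_of_ne (by omega), prod_insert (by simp), ih,
      Nat.sub_add_comm hN, Nat.factorial_succ]
    push_cast [Nat.cast_sub hN]
    ring

-- Barycentric Lagrange interpolation: the weights at the nodes 0, …, N are (-1)^(N-i) binom(N, i) /
-- N!.
open Polynomial in
theorem sum_choose_mul_eval_div (N : ℕ) (f : ℚ[X]) (hf : f.natDegree ≤ N) (s : ℚ)
    (hs : ∀ i ∈ range (N + 1), s ≠ (i : ℚ)) :
    (∏ i ∈ range (N + 1), (s - i)) *
      ∑ i ∈ range (N + 1), (-1 : ℚ) ^ (N - i) * N.choose i * f.eval (i : ℚ) / (s - i)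
      = N ! * f.eval s := by
  have hinj : Set.InjOn (fun i : ℕ => (i : ℚ)) (range (N + 1) : Set ℕ) :=
    fun _ _ _ _ h => by simpa using h
  have hdeg : f.degree < ((range (N + 1)).card : ℕ) := by
    rw [card_range]
    exact lt_of_le_of_lt degree_le_natDegree (by exact_mod_cast Nat.lt_succ_of_le hf)
  conv_rhs => rw [Lagrange.eq_interpolate hinj hdeg,
    Lagrange.eval_interpolate_not_at_node _ hs, Lagrange.eval_nodal]
  rw [mul_left_comm]
  congr 1
  rw [mul_sum]
  refine sum_congr rfl fun i hi => ?_
  have hiN : i ≤ N := by simpa [Nat.lt_succ_iff] using hi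
  rw [Lagrange.nodalWeight, prod_inv_distrib, prod_erase_natCast_sub N i hi,
    Nat.cast_choose ℚ hiN]
  have h₁ : (i ! : ℚ) ≠ 0 := by positivity
  have h₂ : ((N - i)! : ℚ) ≠ 0 := by positivity
  have h₃ : s - i ≠ 0 := sub_ne_zero.mpr (hs i hi)
  rcases neg_one_pow_eq_or ℚ (N - i) with h | h <;> rw [h] <;> field_simp

/-! ### Interpolating c_r(q)/(2q+1). -/

/-- Two runs of consecutive factors exchange their lower ends, which preserves the product. The
cases say which lower end comes first. -/
theorem centralProd_mul_centralProd (r κ i : ℕ) (c : ℚ) (hκ : κ ≤ 2 * r) (hi : i ≤ r) :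
    centralProd (r - i) (c + κ - r) * centralProd i c
      = fallingProd (c + i) (2 * r - κ) * fallingProd (c + κ - i) κ := by
  rw [centralProd_eq_fallingProd, centralProd_eq_fallingProd, Nat.cast_sub hi,
    show c + (κ : ℚ) - r + (r - i) = c + κ - i by ring]
  rcases le_total κ (2 * (r - i)) with h | h
  · obtain ⟨d, hd⟩ := Nat.exists_eq_add_of_le h
    rw [hd, show 2 * r - κ = 2 * i + d by omega, fallingProd_add, fallingProd_add]
    rw [show c + (κ : ℚ) - i - κ = c - i by ring,
      show c + (i : ℚ) - (2 * i : ℕ) = c - i by push_cast; ring]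
    ring
  · obtain ⟨d, hd⟩ := Nat.exists_eq_add_of_le h
    have hd' : (κ : ℚ) = 2 * (r - i) + d := by
      rw [← Nat.cast_sub hi]
      exact_mod_cast hd
    rw [show 2 * i = 2 * r - κ + d by omega]
    nth_rw 5 [hd]
    rw [fallingProd_add, fallingProd_add, Nat.cast_sub hκ]
    push_cast [Nat.cast_sub hi]
    rw [show c + (i : ℚ) - (2 * r - κ) = c + κ - i - 2 * (r - i) by rw [hd']; ring]
    ring

/-- The run from c + i down to c - i + 1 is cut into three pieces, of lengths 2r - κ, 2(i - r) and
κ. -/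
theorem centralProd_eq_mul_centralProd (r κ i : ℕ) (c : ℚ) (hκ : κ ≤ 2 * r) (hi : r ≤ i) :
    centralProd i c = fallingProd (c + i) (2 * r - κ) * fallingProd (c + κ - i) κ
      * centralProd (i - r) (c + κ - r) := by
  rw [centralProd_eq_fallingProd, centralProd_eq_fallingProd,
    show 2 * i = (2 * r - κ) + (2 * (i - r) + κ) by omega, fallingProd_add, fallingProd_add]
  push_cast [Nat.cast_sub hκ, Nat.cast_sub hi]
  rw [show c + (i : ℚ) - (2 * r - κ) = c + κ - r + (i - r) by ring,
    show c + (κ : ℚ) - r + (i - r) - 2 * (i - r) = c + κ - i by ring]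
  ring

/-- The polynomial in `x (x + 1)` that equals `centralProd r x * centralProd (r - i) x` for `i ≤ r`
and `centralProd r x / centralProd (i - r) x` for `r < i`. -/
def centralQuot (r i : ℕ) (x : ℚ) : ℚ :=
  if i ≤ r then centralProd r x * centralProd (r - i) x
  else ∏ t ∈ Ico (i - r) r, (x * (x + 1) - t * (t + 1))

theorem centralQuot_mul_centralProd (r κ i : ℕ) (c : ℚ) (hκ : κ ≤ 2 * r) (hi : i ≤ 2 * r) :
    centralQuot r i (c + κ - r) * centralProd i c = centralProd r (c + κ - r)
      * (fallingProd (c + i) (2 * r - κ) * fallingProd (c + κ - i) κ) := by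
  unfold centralQuot
  split_ifs with h
  · rw [mul_assoc, centralProd_mul_centralProd r κ i c hκ h]
  · rw [centralProd_eq_mul_centralProd r κ i c hκ (by omega)]
    have : centralProd r (c + κ - r) = centralProd (i - r) (c + κ - r) *
        ∏ t ∈ Ico (i - r) r, ((c + κ - r) * ((c + κ - r) + 1) - (t : ℚ) * (t + 1)) := by
      unfold centralProd
      rw [prod_range_mul_prod_Ico _ (by omega)]
    rw [this]
    ring

open Polynomial in
theorem exists_polynomial_fallingProd (a b : ℚ) (κ N : ℕ) (hκ : κ ≤ N) :
    ∃ f : ℚ[X], f.natDegree ≤ N ∧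
      ∀ s, f.eval s = fallingProd (a + s) (N - κ) * fallingProd (b - s) κ := by
  refine ⟨(∏ t ∈ range (N - κ), (X + C (a - t))) * ∏ t ∈ range κ, (C (b - t) - X), ?_, ?_⟩
  · refine natDegree_mul_le.trans ?_
    have h₁ : (∏ t ∈ range (N - κ), (X + C (a - (t : ℚ)))).natDegree ≤ N - κ := by
      refine (natDegree_prod_le _ _).trans ?_
      simp only [natDegree_X_add_C, sum_const, card_range, smul_eq_mul, mul_one, le_refl]
    have h₂ : (∏ t ∈ range κ, (C (b - (t : ℚ)) - X)).natDegree ≤ κ := by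
      refine (natDegree_prod_le _ _).trans ?_
      have h (t : ℕ) : (C (b - (t : ℚ)) - X).natDegree ≤ 1 :=
        (natDegree_sub_le _ _).trans
          (max_le ((natDegree_C _).le.trans zero_le_one) natDegree_X_le)
      refine (sum_le_sum fun t _ => h t).trans ?_
      simp
    omega
  · intro s
    simp only [eval_mul, eval_prod, eval_add, eval_sub, eval_X, eval_C, fallingProd]
    congr 1 <;> exact prod_congr rfl fun _ _ => by ring

/-- At s = r + 1/2 the two falling products run through m + k + 1/2 for k > κ and for k < κ; the
leading factor supplies k = κ. -/
theorem prod_odd_eq_fallingProd (m r κ : ℕ) (hκ : κ ≤ 2 * r) :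
    (2 * ((m : ℚ) + κ) + 1) * (2 ^ (2 * r) * (fallingProd (m + r + (r + 1 / 2)) (2 * r - κ)
      * fallingProd (m + r + κ - (r + 1 / 2)) κ))
      = ∏ k ∈ range (2 * r + 1), (2 * ((m : ℚ) + k) + 1) := by
  have h₀ (a : ℚ) (k : ℕ) : 2 ^ k * fallingProd a k = ∏ t ∈ range k, (2 * (a - t)) := by
    rw [prod_mul_distrib, prod_const, card_range, fallingProd]
  rw [show (2 : ℚ) ^ (2 * r) = 2 ^ (2 * r - κ) * 2 ^ κ by
    rw [← pow_add, Nat.sub_add_cancel hκ], mul_mul_mul_comm, h₀, h₀]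
  obtain ⟨d, hd⟩ := Nat.exists_eq_add_of_le hκ
  have hd' : (2 : ℚ) * r = κ + d := by exact_mod_cast hd
  rw [show 2 * r + 1 = κ + (1 + d) by omega, prod_range_add, prod_range_add, prod_range_one,
    show 2 * r - κ = d by omega, ← prod_range_reflect _ d, ← prod_range_reflect _ κ]
  have h₁ : ∏ j ∈ range κ, 2 * ((m : ℚ) + r + κ - (r + 1 / 2) - ((κ - 1 - j : ℕ) : ℚ))
      = ∏ k ∈ range κ, (2 * ((m : ℚ) + k) + 1) := by
    refine prod_congr rfl fun j hj => ?_
    have : j < κ := mem_range.mp hj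
    rw [Nat.sub_sub, Nat.cast_sub (by omega)]
    push_cast
    ring
  have h₂ : ∏ j ∈ range d, 2 * ((m : ℚ) + r + (r + 1 / 2) - ((d - 1 - j : ℕ) : ℚ))
      = ∏ x ∈ range d, (2 * ((m : ℚ) + ((κ + (1 + x) : ℕ) : ℚ)) + 1) := by
    refine prod_congr rfl fun j hj => ?_
    have : j < d := mem_range.mp hj
    rw [Nat.sub_sub, Nat.cast_sub (by omega)]
    push_cast
    linear_combination 2 * hd'
  rw [h₁, h₂]
  push_cast
  ring

theorem sum_centralQuot_mul_centralProd (m r κ : ℕ) (hκ : κ ≤ 2 * r) :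
    (∏ i ∈ range (2 * r + 1), (2 * (r : ℚ) + 1 - 2 * i)) * ((2 * ((m : ℚ) + κ) + 1) *
      ∑ i ∈ range (2 * r + 1), (-1 : ℚ) ^ i * (2 * r).choose i / (2 * r + 1 - 2 * i)
        * centralProd i (m + r) * centralQuot r i (m + κ))
      = (2 * r)! * (∏ k ∈ range (2 * r + 1), (2 * ((m : ℚ) + k) + 1))
        * centralProd r (m + κ) := by
  obtain ⟨f, hdeg, hf⟩ := exists_polynomial_fallingProd (m + r) (m + r + κ) κ (2 * r) hκ
  have hne (i : ℕ) : (r : ℚ) + 1 / 2 ≠ i := by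
    intro h
    have : ((2 * r + 1 : ℕ) : ℚ) = ((2 * i : ℕ) : ℚ) := by push_cast; linarith
    have : 2 * r + 1 = 2 * i := by exact_mod_cast this
    omega
  have key := sum_choose_mul_eval_div (2 * r) f hdeg (r + 1 / 2) fun i _ => hne i
  have hP : ∏ i ∈ range (2 * r + 1), (2 * (r : ℚ) + 1 - 2 * i)
      = 2 ^ (2 * r + 1) * ∏ i ∈ range (2 * r + 1), ((r : ℚ) + 1 / 2 - i) := by
    conv_rhs => rw [← card_range (2 * r + 1), ← prod_const, card_range, ← prod_mul_distrib]
    exact prod_congr rfl fun _ _ => by ring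
  have hS : ∑ i ∈ range (2 * r + 1), (-1 : ℚ) ^ i * (2 * r).choose i / (2 * r + 1 - 2 * i)
        * centralProd i (m + r) * centralQuot r i (m + κ)
      = centralProd r (m + κ) / 2 * ∑ i ∈ range (2 * r + 1),
        (-1 : ℚ) ^ (2 * r - i) * (2 * r).choose i * f.eval (i : ℚ) / (r + 1 / 2 - i) := by
    rw [mul_sum]
    refine sum_congr rfl fun i hi => ?_
    have hi' : i ≤ 2 * r := by simpa [Nat.lt_succ_iff] using hi
    have h := centralQuot_mul_centralProd r κ i (m + r) hκ hi'
    rw [show (m : ℚ) + r + κ - r = m + κ by ring] at h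
    rw [hf, show ((-1 : ℚ) ^ (2 * r - i)) = (-1) ^ i by
      rcases Nat.even_or_odd i with he | ho
      · rw [he.neg_one_pow, ((Nat.even_sub hi').mpr (by simp [he])).neg_one_pow]
      · rw [ho.neg_one_pow, (Nat.Even.sub_odd hi' (by simp) ho).neg_one_pow]]
    have h₁ : (r : ℚ) + 1 / 2 - i ≠ 0 := sub_ne_zero.mpr (hne i)
    rw [show 2 * (r : ℚ) + 1 - 2 * i = 2 * (r + 1 / 2 - i) by ring]
    generalize (r : ℚ) + 1 / 2 - i = u at *
    field_simp
    linear_combination (2 * r).choose i * h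
  rw [hS, hP, ← prod_odd_eq_fallingProd m r κ hκ, ← hf]
  linear_combination (2 ^ (2 * r) * (2 * ((m : ℚ) + κ) + 1) * centralProd r (m + κ)) * key

/-! ### Newton expansions and the coefficient of c_r. -/

open Polynomial in
theorem exists_newton_expansion (d : ℕ) (v : ℕ → ℚ) (f : ℚ[X]) (hf : f.natDegree ≤ d) :
    ∃ h : ℕ → ℚ, h 0 = f.eval (v 0) ∧
      ∀ y, f.eval y = ∑ l ∈ range (d + 1), h l * ∏ t ∈ range l, (y - v t) := by
  induction d generalizing v f with
  | zero =>
    refine ⟨fun _ => f.eval (v 0), rfl, fun y => ?_⟩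
    rw [eq_C_of_natDegree_le_zero hf]
    simp
  | succ d ih =>
    obtain ⟨h, -, hh⟩ := ih (fun t => v (t + 1)) (f /ₘ (X - C (v 0))) (by
      rw [natDegree_divByMonic _ (monic_X_sub_C _), natDegree_X_sub_C]
      omega)
    refine ⟨fun l => Nat.casesOn l (f.eval (v 0)) h, rfl, fun y => ?_⟩
    have := congrArg (eval y) (modByMonic_add_div f (X - C (v 0)))
    rw [modByMonic_X_sub_C_eq_C_eval, eval_add, eval_C, eval_mul, eval_sub, eval_X, eval_C,
      hh y] at this
    rw [sum_range_succ', ← this, mul_sum, add_comm]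
    congr 1
    · refine sum_congr rfl fun l _ => ?_
      rw [prod_range_succ']
      ring
    · simp

-- For i ≤ r, c_r is a factor and the cofactor is expanded from the node r(r+1) on, so its value
-- there is the coefficient of c_r. For i > r the degree in x(x+1) is 2r - i < r, so c_r does not
-- occur.
open Polynomial in
theorem exists_centralQuot_expansion (r i : ℕ) (hi : i ≤ 2 * r) :
    ∃ h : ℕ → ℚ, h r = (if i ≤ r then centralProd (r - i) r else 0) ∧
      ∀ x, centralQuot r i x = ∑ l ∈ range (2 * r + 1), h l * centralProd l x := by
  have hdeg (s : Finset ℕ) :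
      (∏ t ∈ s, (X - C ((t : ℚ) * (t + 1)))).natDegree ≤ s.card := by
    refine (natDegree_prod_le _ _).trans ?_
    simp only [natDegree_X_sub_C, sum_const, smul_eq_mul, mul_one, le_refl]
  by_cases hir : i ≤ r
  · obtain ⟨h, h₀, hh⟩ := exists_newton_expansion r (fun t => ((r + t : ℕ) : ℚ) * ((r + t : ℕ) + 1))
      (∏ t ∈ range (r - i), (X - C ((t : ℚ) * (t + 1)))) ((hdeg _).trans (by simp))
    refine ⟨fun l => if r ≤ l then h (l - r) else 0, ?_, fun x => ?_⟩
    · simp [hir, h₀, eval_prod, centralProd]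
    · have := hh (x * (x + 1))
      rw [eval_prod] at this
      simp only [eval_sub, eval_X, eval_C] at this
      rw [centralQuot, if_pos hir]
      change _ * (∏ t ∈ range (r - i), _) = _
      rw [this, show 2 * r + 1 = r + (r + 1) by ring, mul_sum, sum_range_add _ r (r + 1),
        sum_eq_zero (s := range r), zero_add]
      · refine sum_congr rfl fun l _ => ?_
        beta_reduce
        rw [if_pos (by omega), Nat.add_sub_cancel_left]
        simp only [centralProd]
        rw [prod_range_add]
        ring
      · intro l hl
        beta_reduce
        rw [if_neg (by simpa using hl), zero_mul]
  · obtain ⟨h, -, hh⟩ := exists_newton_expansion (r - 1) (fun t => (t : ℚ) * (t + 1))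
      (∏ t ∈ Ico (i - r) r, (X - C ((t : ℚ) * (t + 1)))) ((hdeg _).trans (by simp; omega))
    refine ⟨fun l => if l < r then h l else 0, by simp [hir], fun x => ?_⟩
    have := hh (x * (x + 1))
    rw [eval_prod] at this
    simp only [eval_sub, eval_X, eval_C] at this
    rw [centralQuot, if_neg hir, this, show r - 1 + 1 = r by omega,
      show 2 * r + 1 = r + (r + 1) by ring, sum_range_add, sum_eq_zero (s := range (r + 1)),
      add_zero]
    · refine sum_congr rfl fun l hl => ?_
      beta_reduce
      rw [if_pos (by simpa using hl)]
      rfl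
    · intro l _
      beta_reduce
      rw [if_neg (by omega), zero_mul]

/-! ### Reduction to central factorials. -/

/-- The binomial coefficient `a.choose (L - j)`, equal to `0` for `L < j`. -/
def chooseSub (a L j : ℕ) : ℚ := if j ≤ L then (a.choose (L - j) : ℚ) else 0

theorem sum_choose_mul_chooseSub (a L κ N : ℕ) (hκ : κ ≤ N) :
    ∑ j ∈ range (N + 1), chooseSub a L j * κ.choose j = (a + κ).choose L := by
  have h₁ : ∑ j ∈ range (N + 1), chooseSub a L j * κ.choose j
      = ∑ j ∈ range (N + L + 1), chooseSub a L j * κ.choose j := by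
    refine sum_subset (range_mono (by omega)) fun j _ hj => ?_
    rw [Nat.choose_eq_zero_of_lt (n := κ) (by simp at hj; omega)]
    simp
  have h₂ : ∑ j ∈ range (L + 1), chooseSub a L j * κ.choose j
      = ∑ j ∈ range (N + L + 1), chooseSub a L j * κ.choose j := by
    refine sum_subset (range_mono (by omega)) fun j _ hj => ?_
    rw [chooseSub, if_neg (by simp at hj; omega), zero_mul]
  rw [h₁, ← h₂, add_comm a κ, Nat.add_choose_eq, Finset.Nat.sum_antidiagonal_eq_sum_range_succ_mk]
  push_cast
  refine sum_congr rfl fun j hj => ?_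
  rw [chooseSub, if_pos (by simp at hj; omega)]
  ring

theorem invFactorial_natCast (k : ℕ) : invFactorial k = 1 / (k ! : ℚ) := by
  simp [invFactorial]

theorem invFactorial_of_neg (k : ℤ) (hk : k < 0) : invFactorial k = 0 := by
  simp [invFactorial, hk]

theorem halfHexEntry_reflect_of_ne (r m l j : ℕ) (hl : l ≤ 2 * r) (hj : j ≤ 2 * r) (hlr : l ≠ r) :
    halfHexEntry (r + 1) m (2 * r + 1 - l) (2 * r + 1 - j)
      = chooseSub (m + l) (2 * l + 1) j + chooseSub (m + l) (2 * l) j / 2 := by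
  rw [halfHexEntry, if_neg (by omega), show 2 * (r + 1) + m - (2 * r + 1 - l) - 1 = m + l by omega,
    show (m : ℤ) + (2 * r + 1 - l : ℕ) - (2 * r + 1 - j : ℕ) = (m : ℤ) + j - l by omega,
    show 2 * ((r + 1 : ℕ) : ℤ) - 2 * ((2 * r + 1 - l : ℕ) : ℤ) + ((2 * r + 1 - j : ℕ) : ℤ)
      = 2 * (l : ℤ) + 1 - j by omega, Nat.cast_sub (by omega : j ≤ 2 * r + 1), chooseSub, chooseSub]
  rcases lt_trichotomy j (2 * l + 1) with h | h | h
  · rw [if_pos h.le, if_pos (by omega)]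
    obtain ⟨t, ht⟩ := Nat.exists_eq_add_of_le (show j ≤ 2 * l by omega)
    rw [show 2 * l + 1 - j = t + 1 by omega, show 2 * l - j = t by omega,
      show 2 * (l : ℤ) + 1 - j = ((t + 1 : ℕ) : ℤ) by omega, invFactorial_natCast]
    rcases le_or_gt t (m + l) with hk | hk
    · obtain ⟨k, hk⟩ := Nat.exists_eq_add_of_le hk
      have hc := cast_choose_succ_mul (m + l) t
      have hc' := Nat.choose_mul_factorial_mul_factorial (show t ≤ m + l by omega)
      rw [show m + l - t = k by omega] at hc'
      have hc'' : ((m + l)! : ℚ) = (m + l).choose t * t ! * k ! := by exact_mod_cast hc'.symm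
      rw [show (m : ℤ) + j - l = (k : ℤ) by omega, invFactorial_natCast, Nat.factorial_succ, hc'']
      have h₁ : (t ! : ℚ) ≠ 0 := by positivity
      have h₂ : (k ! : ℚ) ≠ 0 := by positivity
      have hk' : (m : ℚ) + l = t + k := by exact_mod_cast hk
      have ht' : 2 * (l : ℚ) = j + t := by exact_mod_cast ht
      have h₃ : (t : ℚ) + 1 ≠ 0 := by positivity
      have hc₃ : ((m + l).choose (t + 1) : ℚ) = (m + l).choose t * k / (t + 1) := by
        rw [eq_div_iff h₃, hc]
        push_cast
        rw [hk']
        ring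
      rw [hc₃]
      push_cast
      field_simp
      linear_combination 2 * ((m + l).choose t : ℚ) * hk' - ((m + l).choose t : ℚ) * ht'
    · rw [invFactorial_of_neg _ (by omega), Nat.choose_eq_zero_of_lt hk,
        Nat.choose_eq_zero_of_lt (by omega)]
      simp
  -- For j = 2l + 1 the second binomial is 0 only by the guard in `chooseSub`; truncated subtraction
  -- would give 1.
  · rw [if_pos h.le, if_neg (by omega), show 2 * (l : ℤ) + 1 - j = ((0 : ℕ) : ℤ) by omega,
      show (m : ℤ) + j - l = ((m + l + 1 : ℕ) : ℤ) by omega, invFactorial_natCast,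
      invFactorial_natCast, Nat.factorial_succ, h]
    have h₁ : ((m + l)! : ℚ) ≠ 0 := by positivity
    have h₂ : (m : ℚ) + l + 1 ≠ 0 := by positivity
    push_cast
    simp only [Nat.sub_self, Nat.choose_zero_right, Nat.factorial_zero]
    field_simp
    push_cast
    ring
  · rw [if_neg (by omega), if_neg (by omega), invFactorial_of_neg (2 * (l : ℤ) + 1 - j) (by omega)]
    simp

theorem halfHexEntry_reflect_self (r m j : ℕ) (hj : j ≤ 2 * r) :
    halfHexEntry (r + 1) m (2 * r + 1 - r) (2 * r + 1 - j) = chooseSub (m + r) (2 * r) j := by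
  rw [halfHexEntry, if_pos (by omega), show 2 * (r + 1) + m - (2 * r + 1 - r) - 1 = m + r by omega,
    show (m : ℤ) + (2 * r + 1 - r : ℕ) - (2 * r + 1 - j : ℕ) = (m : ℤ) + j - r by omega,
    show 2 * ((r + 1 : ℕ) : ℤ) - 2 * ((2 * r + 1 - r : ℕ) : ℤ) + ((2 * r + 1 - j : ℕ) : ℤ)
      = ((2 * r - j + 1 : ℕ) : ℤ) by omega, chooseSub, if_pos hj,
    show 2 * r + 1 - j = 2 * r - j + 1 by omega]
  obtain ⟨t, ht⟩ := Nat.exists_eq_add_of_le hj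
  rw [show 2 * r - j = t by omega, invFactorial_natCast, Nat.factorial_succ]
  rcases le_or_gt t (m + r) with hk | hk
  · obtain ⟨k, hk⟩ := Nat.exists_eq_add_of_le hk
    rw [show (m : ℤ) + j - r = (k : ℤ) by omega, invFactorial_natCast,
      Nat.cast_choose ℚ (show t ≤ m + r by omega), show m + r - t = k by omega]
    push_cast
    field_simp
  · rw [invFactorial_of_neg _ (by omega), Nat.choose_eq_zero_of_lt hk]
    simp

/-- The matrix with entries `(2 q + 1) (q + l)! / (2 (2 l + 1)! (q - l)!)`, where `q = m + k`. -/
def centralMatrix (m N : ℕ) : Matrix (Fin N) (Fin N) ℚ :=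
  Matrix.of fun l k => (2 * ((m : ℚ) + k) + 1) * centralProd l (m + k) / (2 * (2 * (l : ℕ) + 1)!)

theorem choose_add_half_choose (l q : ℕ) :
    ((q + l).choose (2 * l + 1) : ℚ) + (q + l).choose (2 * l) / 2
      = (2 * (q : ℚ) + 1) * centralProd l q / (2 * (2 * l + 1)!) := by
  have h := cast_choose_succ_mul (q + l) (2 * l)
  rw [centralProd_natCast, Nat.factorial_succ]
  push_cast at h ⊢
  field_simp
  linear_combination 2 * h

theorem det_pascal (N : ℕ) :
    (Matrix.of fun j k : Fin N => ((k : ℕ).choose (j : ℕ) : ℚ)).det = 1 := by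
  rw [Matrix.det_of_isUpperTriangular]
  · simp
  · intro j k h
    simp only [id_eq] at h
    simp [Nat.choose_eq_zero_of_lt (Fin.lt_def.mp h)]

theorem halfHexMatrix_det_eq (r m : ℕ) :
    (halfHexMatrix (r + 1) m).det
      = ((centralMatrix m (2 * r + 1)).updateRow ⟨r, by omega⟩
          fun k => centralProd r (m + (k : ℕ)) / (2 * r)!).det := by
  -- The same reversal acts on rows and columns, so no sign appears.
  let e : Fin (2 * r + 1) ≃ Fin (2 * (r + 1) - 1) := Fin.revPerm.trans (finCongr (by omega))
  have he (l : Fin (2 * r + 1)) : ((e l : Fin _) : ℕ) + 1 = 2 * r + 1 - l := by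
    simp only [e, Equiv.trans_apply, Fin.revPerm_apply, finCongr_apply, Fin.val_cast, Fin.val_rev]
    omega
  rw [← Matrix.det_submatrix_equiv_self e, ← mul_one (Matrix.det _), ← det_pascal (2 * r + 1),
    ← Matrix.det_mul]
  congr 1
  ext l k
  have hk : (k : ℕ) ≤ 2 * r := by omega
  have hl : (l : ℕ) ≤ 2 * r := by omega
  simp only [Matrix.mul_apply, Matrix.submatrix_apply, halfHexMatrix, Matrix.of_apply, he]
  rw [Fin.sum_univ_eq_sum_range (fun j => halfHexEntry (r + 1) m (2 * r + 1 - l) (2 * r + 1 - j)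
    * ((k : ℕ).choose j : ℚ)), Matrix.updateRow_apply]
  split_ifs with h
  · have hlr : (l : ℕ) = r := by rw [h]
    rw [hlr, sum_congr rfl fun j hj => by
      rw [halfHexEntry_reflect_self r m j (by simp at hj; omega)],
      sum_choose_mul_chooseSub _ _ _ _ hk]
    have := centralProd_natCast r (m + k)
    push_cast at this
    rw [this, show m + r + (k : ℕ) = m + k + r by ring]
    field_simp
  · have hlr : (l : ℕ) ≠ r := fun h' => h (Fin.ext h')
    rw [sum_congr rfl fun j hj => by
      rw [halfHexEntry_reflect_of_ne r m l j hl (by simp at hj; omega) hlr, add_mul,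
        div_mul_eq_mul_div], sum_add_distrib, ← sum_div,
      sum_choose_mul_chooseSub _ _ _ _ hk, sum_choose_mul_chooseSub _ _ _ _ hk,
      show m + (l : ℕ) + (k : ℕ) = m + k + l by ring, choose_add_half_choose]
    simp [centralMatrix]

/-! ### The Vandermonde determinant. -/

theorem ascPochhammer_eval_eq_prod_range (k : ℕ) (a : ℚ) :
    (ascPochhammer ℚ k).eval a = ∏ t ∈ range k, (a + t) := by
  induction k with
  | zero => simp
  | succ k ih => rw [ascPochhammer_succ_eval, ih, prod_range_succ]

-- The differences of the nodes q(q+1) factor as (j - i)(2m + i + j + 1); for fixed j the product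
-- over i < j is j! (2m+j+1)_j.
open Polynomial in
theorem det_centralProd (m N : ℕ) :
    (Matrix.of fun l k : Fin N => centralProd l ((m : ℚ) + (k : ℕ))).det
      = ∏ i ∈ range N, (i ! * (ascPochhammer ℚ i).eval (2 * (m : ℚ) + i + 1)) := by
  rw [← Matrix.det_transpose]
  have h := Matrix.det_eval_matrixOfPolynomials_eq_det_vandermonde
    (fun k : Fin N => ((m : ℚ) + (k : ℕ)) * ((m : ℚ) + (k : ℕ) + 1))
    (fun l => ∏ t ∈ range l, (X - C ((t : ℚ) * (t + 1))))
    (fun l => by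
      rw [natDegree_prod_of_monic _ _ fun t _ => monic_X_sub_C _]
      simp only [natDegree_X_sub_C, sum_const, card_range, smul_eq_mul, mul_one])
    (fun l => monic_prod_of_monic _ _ fun t _ => monic_X_sub_C _)
  have h' : (Matrix.of fun l k : Fin N => centralProd l ((m : ℚ) + (k : ℕ))).transpose
      = Matrix.of fun k l : Fin N => (∏ t ∈ range l, (X - C ((t : ℚ) * (t + 1)))).eval
        (((m : ℚ) + (k : ℕ)) * ((m : ℚ) + (k : ℕ) + 1)) := by
    ext k l
    simp [eval_prod, centralProd]
  rw [h', ← h, Matrix.det_vandermonde]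
  have hswap : ∏ i : Fin N, ∏ j ∈ Ioi i, (((m : ℚ) + (j : ℕ)) * ((m : ℚ) + (j : ℕ) + 1)
        - ((m : ℚ) + (i : ℕ)) * ((m : ℚ) + (i : ℕ) + 1))
      = ∏ j : Fin N, ∏ i ∈ Iio j, (((m : ℚ) + (j : ℕ)) * ((m : ℚ) + (j : ℕ) + 1)
        - ((m : ℚ) + (i : ℕ)) * ((m : ℚ) + (i : ℕ) + 1)) :=
    prod_comm' (by simp)
  have hin (j : Fin N) : ∏ i ∈ Iio j, (((m : ℚ) + (j : ℕ)) * ((m : ℚ) + (j : ℕ) + 1)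
        - ((m : ℚ) + (i : ℕ)) * ((m : ℚ) + (i : ℕ) + 1))
      = (j : ℕ)! * (ascPochhammer ℚ j).eval (2 * (m : ℚ) + (j : ℕ) + 1) := by
    have hmap : ∏ i ∈ Iio j, (((m : ℚ) + (j : ℕ)) * ((m : ℚ) + (j : ℕ) + 1)
        - ((m : ℚ) + (i : ℕ)) * ((m : ℚ) + (i : ℕ) + 1))
      = ∏ i ∈ range j, (((m : ℚ) + (j : ℕ)) * ((m : ℚ) + (j : ℕ) + 1)
        - ((m : ℚ) + i) * ((m : ℚ) + i + 1)) := by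
      rw [← Nat.Iio_eq_range, ← Fin.map_valEmbedding_Iio, prod_map]
      rfl
    rw [hmap, ascPochhammer_eval_eq_prod_range, ← prod_range_add_one_eq_factorial,
      ← prod_range_reflect (fun i => i + 1)]
    push_cast
    rw [← prod_mul_distrib]
    refine prod_congr rfl fun i hi => ?_
    have hij : i < (j : ℕ) := mem_range.mp hi
    rw [Nat.sub_sub, Nat.cast_sub (by omega)]
    push_cast
    ring
  rw [hswap, prod_congr rfl fun j _ => hin j]
  exact Fin.prod_univ_eq_prod_range
    (fun j => ((j ! : ℕ) : ℚ) * (ascPochhammer ℚ j).eval (2 * (m : ℚ) + j + 1)) N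

theorem det_centralMatrix (m N : ℕ) :
    (centralMatrix m N).det = (∏ k ∈ range N, (2 * ((m : ℚ) + k) + 1))
      * (∏ l ∈ range N, (2 * ((2 * l + 1)! : ℚ)))⁻¹
      * ∏ i ∈ range N, (i ! * (ascPochhammer ℚ i).eval (2 * (m : ℚ) + i + 1)) := by
  have h : centralMatrix m N = Matrix.of fun l k : Fin N => (2 * ((2 * (l : ℕ) + 1)! : ℚ))⁻¹ *
      (Matrix.of fun l k : Fin N => (2 * ((m : ℚ) + (k : ℕ)) + 1) *
        (Matrix.of fun l k : Fin N => centralProd l ((m : ℚ) + (k : ℕ))) l k) l k := by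
    ext l k
    simp only [centralMatrix, Matrix.of_apply]
    ring
  rw [h, Matrix.det_mul_column, Matrix.det_mul_row, det_centralProd,
    Fin.prod_univ_eq_prod_range (fun l => (2 * ((2 * l + 1)! : ℚ))⁻¹),
    Fin.prod_univ_eq_prod_range (fun k => 2 * ((m : ℚ) + k) + 1), prod_inv_distrib]
  ring

/-! ### Expansion of the exceptional row. -/

theorem exists_centralProd_combination (m r : ℕ) :
    ∃ h : ℕ → ℚ, h r = (2 * r)! * ∑ i ∈ range (r + 1),
        (-1 : ℚ) ^ i / (2 * r + 1 - 2 * i) * (centralProd i (m + r) / (i ! : ℚ) ^ 2) ∧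
      ∀ κ ≤ 2 * r, (∏ i ∈ range (2 * r + 1), (2 * (r : ℚ) + 1 - 2 * i)) *
        ((2 * ((m : ℚ) + κ) + 1) * ∑ l ∈ range (2 * r + 1), h l * centralProd l (m + κ))
        = (2 * r)! * (∏ k ∈ range (2 * r + 1), (2 * ((m : ℚ) + k) + 1))
          * centralProd r (m + κ) := by
  choose! g hg₀ hg using exists_centralQuot_expansion r
  refine ⟨fun l => ∑ i ∈ range (2 * r + 1), (-1 : ℚ) ^ i * (2 * r).choose i / (2 * r + 1 - 2 * i)
    * centralProd i (m + r) * g i l, ?_, fun κ hκ => ?_⟩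
  · beta_reduce
    rw [show 2 * r + 1 = r + 1 + r by ring, sum_range_add, sum_eq_zero (s := range r), add_zero,
      mul_sum]
    · refine sum_congr rfl fun i hi => ?_
      have hir : i ≤ r := by simpa [Nat.lt_succ_iff] using hi
      rw [hg₀ i (by omega), if_pos hir, eq_div_of_mul_eq (by positivity) (centralProd_self r i hir),
        Nat.cast_choose ℚ (show i ≤ 2 * r by omega)]
      have h₁ : ((2 * r - i)! : ℚ) ≠ 0 := by positivity
      have h₂ : 2 * (r : ℚ) + 1 - 2 * i ≠ 0 := by
        have : (i : ℚ) ≤ r := by exact_mod_cast hir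
        linarith
      field_simp
    · intro i hi
      have : i < r := mem_range.mp hi
      rw [hg₀ _ (by omega), if_neg (by omega), mul_zero]
  · rw [← sum_centralQuot_mul_centralProd m r κ hκ]
    congr 2
    simp only [sum_mul]
    rw [sum_comm]
    refine sum_congr rfl fun i hi => ?_
    rw [hg i (by simpa [Nat.lt_succ_iff] using hi), mul_sum]
    exact sum_congr rfl fun l _ => by ring

theorem halfHexMatrix_det_eq_mul_sum (r m : ℕ) :
    (halfHexMatrix (r + 1) m).det
      = (∏ i ∈ range (2 * r + 1), (2 * (r : ℚ) + 1 - 2 * i)) * (2 * (2 * r + 1))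
        * (∏ l ∈ range (2 * r + 1), (2 * ((2 * l + 1)! : ℚ)))⁻¹
        * (∏ i ∈ range (2 * r + 1), (i ! * (ascPochhammer ℚ i).eval (2 * (m : ℚ) + i + 1)))
        * ∑ i ∈ range (r + 1),
          (-1 : ℚ) ^ i / (2 * r + 1 - 2 * i) * (centralProd i (m + r) / (i ! : ℚ) ^ 2) := by
  obtain ⟨h, h₀, hh⟩ := exists_centralProd_combination m r
  set P := ∏ i ∈ range (2 * r + 1), (2 * (r : ℚ) + 1 - 2 * i)
  have hA : ∏ k ∈ range (2 * r + 1), (2 * ((m : ℚ) + k) + 1) ≠ 0 :=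
    prod_ne_zero_iff.mpr fun k _ => by positivity
  rw [halfHexMatrix_det_eq]
  set A := ∏ k ∈ range (2 * r + 1), (2 * ((m : ℚ) + k) + 1) with hAdef
  have hrow : (fun k : Fin (2 * r + 1) => centralProd r (m + (k : ℕ)) / ((2 * r)! : ℚ))
      = ∑ l : Fin (2 * r + 1), (P * h l * (2 * (2 * (l : ℕ) + 1)!) / (((2 * r)! : ℚ) ^ 2 * A)) •
        centralMatrix m (2 * r + 1) l := by
    ext k
    have hk := hh k (by omega)
    have hf : ((2 * r)! : ℚ) ≠ 0 := by positivity
    have hk' : centralProd r (m + (k : ℕ)) / ((2 * r)! : ℚ) = P * ((2 * ((m : ℚ) + (k : ℕ)) + 1) *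
        ∑ l ∈ range (2 * r + 1), h l * centralProd l (m + (k : ℕ))) / (((2 * r)! : ℚ) ^ 2 * A) := by
      rw [hk]
      field_simp
    rw [hk', Finset.sum_apply]
    simp only [Pi.smul_apply, smul_eq_mul, centralMatrix, Matrix.of_apply]
    rw [Fin.sum_univ_eq_sum_range (fun l => P * h l * (2 * (2 * l + 1)!) / (((2 * r)! : ℚ) ^ 2 * A)
      * ((2 * ((m : ℚ) + (k : ℕ)) + 1) * centralProd l (m + (k : ℕ)) / (2 * (2 * l + 1)!))),
      mul_sum, mul_sum, sum_div]
    refine sum_congr rfl fun l _ => ?_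
    field_simp
  -- Every summand but row r repeats another row, so only the coefficient at l = r remains.
  rw [hrow, Matrix.det_updateRow_sum, det_centralMatrix, ← hAdef, smul_eq_mul, h₀,
    Nat.factorial_succ]
  have hf : ((2 * r)! : ℚ) ≠ 0 := by positivity
  push_cast
  field_simp

/-! ### Matching the constants. -/

theorem prod_odd_centered (r : ℕ) :
    (∏ i ∈ range (2 * r + 1), (2 * (r : ℚ) + 1 - 2 * i)) * (2 * r + 1)
      = (-1) ^ r * (∏ i ∈ range (r + 1), (2 * (i : ℚ) + 1)) ^ 2 := by
  rw [show 2 * r + 1 = r + 1 + r by ring, prod_range_add, ← prod_range_reflect _ (r + 1)]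
  have h₁ : ∏ j ∈ range (r + 1), (2 * (r : ℚ) + 1 - 2 * ((r + 1 - 1 - j : ℕ) : ℚ))
      = ∏ i ∈ range (r + 1), (2 * (i : ℚ) + 1) := by
    refine prod_congr rfl fun j hj => ?_
    have : j < r + 1 := mem_range.mp hj
    rw [Nat.add_sub_cancel, Nat.cast_sub (by omega)]
    ring
  have h₂ : ∏ x ∈ range r, (2 * (r : ℚ) + 1 - 2 * ((r + 1 + x : ℕ) : ℚ))
      = (-1) ^ r * ∏ i ∈ range r, (2 * (i : ℚ) + 1) := by
    conv_rhs => rw [← card_range r, ← prod_const, card_range, ← prod_mul_distrib]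
    exact prod_congr rfl fun _ _ => by push_cast; ring
  rw [h₁, h₂, prod_range_succ]
  ring

/-- From r to r + 1 both sides gain (2r+3)!²; on the left, 2(r+1) raises the new factor (2r+1)! to
(2r+2)!. -/
theorem prod_odd_sq_mul_prod_factorial (r : ℕ) :
    (2 : ℚ) ^ r * r ! * (∏ i ∈ range (r + 1), (2 * (i : ℚ) + 1)) ^ 2
        * ∏ i ∈ range (2 * r + 1), (i ! : ℚ)
      = ∏ i ∈ Icc 1 (r + 1), ((2 * i - 1)! : ℚ) ^ 2 := by
  induction r with
  | zero => simp
  | succ r ih =>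
    rw [prod_Icc_succ_top (by omega), ← ih, prod_range_succ _ (r + 1),
      show 2 * (r + 1) + 1 = 2 * r + 1 + 1 + 1 by ring,
      prod_range_succ _ (2 * r + 1 + 1), prod_range_succ _ (2 * r + 1),
      show 2 * (r + 1 + 1) - 1 = 2 * r + 1 + 1 + 1 by omega]
    simp only [Nat.factorial_succ]
    push_cast
    ring

theorem centralProd_eq_ascPochhammer (i : ℕ) (x : ℚ) :
    centralProd i x = (ascPochhammer ℚ (2 * i)).eval (x + 1 - i) := by
  rw [centralProd_eq_fallingProd, fallingProd, ← prod_range_reflect,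
    ascPochhammer_eval_eq_prod_range]
  refine prod_congr rfl fun j hj => ?_
  have : j < 2 * i := mem_range.mp hj
  rw [Nat.sub_sub, Nat.cast_sub (by omega)]
  push_cast
  ring

/-- Under i ↦ 2r + 2 - i the numerators become the factors (m+i-1)! and cancel. -/
theorem prod_factorial_quotient (r m : ℕ) :
    ∏ i ∈ Icc 1 (2 * r + 1),
        ((2 * (r + 1) + m - i - 1)! : ℚ) / (((m + i - 1)! : ℚ) * ((4 * (r + 1) - 2 * i - 1)! : ℚ))
      = (∏ l ∈ range (2 * r + 1), ((2 * l + 1)! : ℚ))⁻¹ := by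
  have hI : Icc 1 (2 * r + 1) = Ico 1 (2 * r + 1 + 1) := rfl
  rw [hI, prod_Ico_eq_prod_range, Nat.add_sub_cancel]
  have h : ∏ k ∈ range (2 * r + 1), ((2 * (r + 1) + m - (1 + k) - 1)! : ℚ)
      / (((m + (1 + k) - 1)! : ℚ) * ((4 * (r + 1) - 2 * (1 + k) - 1)! : ℚ))
      = ∏ k ∈ range (2 * r + 1), ((m + (2 * r + 1 - 1 - k))! : ℚ)
        / (((m + k)! : ℚ) * ((2 * (2 * r + 1 - 1 - k) + 1)! : ℚ)) := by
    refine prod_congr rfl fun k hk => ?_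
    have : k < 2 * r + 1 := mem_range.mp hk
    rw [show 2 * (r + 1) + m - (1 + k) - 1 = m + (2 * r + 1 - 1 - k) by omega,
      show m + (1 + k) - 1 = m + k by omega,
      show 4 * (r + 1) - 2 * (1 + k) - 1 = 2 * (2 * r + 1 - 1 - k) + 1 by omega]
  rw [h, prod_div_distrib, prod_mul_distrib,
    prod_range_reflect (fun k => ((m + k)! : ℚ)),
    prod_range_reflect (fun k => ((2 * k + 1)! : ℚ))]
  have h₁ : ∏ k ∈ range (2 * r + 1), ((m + k)! : ℚ) ≠ 0 :=
    prod_ne_zero_iff.mpr fun k _ => by positivity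
  field_simp

theorem lemma16 (n m : ℕ) (hn : 1 ≤ n) :
    (halfHexMatrix n m).det =
      1 / ((2 : ℚ) ^ (3 * n - 3) * ((n - 1)! : ℚ))
        * (∏ i ∈ Finset.Icc 1 n, ((2 * i - 1)! : ℚ) ^ 2)
        * (∏ i ∈ Finset.Icc 1 (2 * n - 1),
            ((2 * n + m - i - 1)! : ℚ) / (((m + i - 1)! : ℚ) * ((4 * n - 2 * i - 1)! : ℚ)))
        * (∏ i ∈ Finset.Icc 1 (2 * n - 2), (ascPochhammer ℚ i).eval (2 * (m : ℚ) + i + 1))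
        * ∑ i ∈ Finset.range n,
            (-1 : ℚ) ^ (n - i - 1) / (2 * (n : ℚ) - 2 * i - 1)
              * ((ascPochhammer ℚ (2 * i)).eval ((m : ℚ) + n - i) / (i ! : ℚ) ^ 2) := by
  obtain ⟨r, rfl⟩ : ∃ r, n = r + 1 := ⟨n - 1, by omega⟩
  have hsum : ∑ i ∈ range (r + 1), (-1 : ℚ) ^ (r + 1 - i - 1) / (2 * ((r + 1 : ℕ) : ℚ) - 2 * i - 1)
        * ((ascPochhammer ℚ (2 * i)).eval ((m : ℚ) + (r + 1 : ℕ) - i) / (i ! : ℚ) ^ 2)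
      = (-1) ^ r * ∑ i ∈ range (r + 1),
          (-1 : ℚ) ^ i / (2 * r + 1 - 2 * i) * (centralProd i (m + r) / (i ! : ℚ) ^ 2) := by
    rw [mul_sum]
    refine sum_congr rfl fun i hi => ?_
    obtain ⟨d, rfl⟩ := Nat.exists_eq_add_of_le (show i ≤ r by simpa [Nat.lt_succ_iff] using hi)
    have hsq : (-1 : ℚ) ^ i * (-1) ^ i = 1 := by rw [← mul_pow]; simp
    rw [centralProd_eq_ascPochhammer, show i + d + 1 - i - 1 = d by omega, pow_add]
    push_cast
    rw [show (m : ℚ) + (i + d + 1) - i = m + (i + d) + 1 - i by ring,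
      show 2 * ((i : ℚ) + d + 1) - 2 * i - 1 = 2 * (i + d) + 1 - 2 * i by ring]
    linear_combination (-(-1 : ℚ) ^ d / (2 * (i + d) + 1 - 2 * i)
      * ((ascPochhammer ℚ (2 * i)).eval ((m : ℚ) + (i + d) + 1 - i) / (i ! : ℚ) ^ 2)) * hsq
  have hpoch : ∏ i ∈ Icc 1 (2 * r), (ascPochhammer ℚ i).eval (2 * (m : ℚ) + i + 1)
      = ∏ i ∈ range (2 * r + 1), (ascPochhammer ℚ i).eval (2 * (m : ℚ) + i + 1) := by
    rw [prod_range_succ']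
    have hI : Icc 1 (2 * r) = Ico 1 (2 * r + 1) := rfl
    rw [hI, prod_Ico_eq_prod_range, Nat.add_sub_cancel]
    simp [add_comm]
  rw [halfHexMatrix_det_eq_mul_sum, hsum, show 2 * (r + 1) - 1 = 2 * r + 1 by omega, show 2 * (r + 1) - 2 = 2 * r by omega,
    show 3 * (r + 1) - 3 = 2 * r + r by omega, Nat.add_sub_cancel, prod_factorial_quotient, hpoch,
    ← prod_odd_sq_mul_prod_factorial, prod_mul_distrib,
    prod_mul_distrib, prod_const, card_range]
  have hP := prod_odd_centered r
  set P := ∏ i ∈ range (2 * r + 1), (2 * (r : ℚ) + 1 - 2 * i)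
  have hL : ∏ l ∈ range (2 * r + 1), ((2 * l + 1)! : ℚ) ≠ 0 :=
    prod_ne_zero_iff.mpr fun k _ => by positivity
  rw [show P * (2 * (2 * (r : ℚ) + 1)) = 2 * (P * (2 * r + 1)) by ring, hP, pow_add, pow_succ]
  field_simp
  rw [pow_add]
  ring
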